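/- Let $V$ be a finite-dimensional complex Hilbert space, with inner product $\langle\cdot|\cdot\rangle$ antilinear in the first variable. Give the symmetric algebra $SV=\bigoplus_{d\ge 0}S^dV$ the inner product for which the summands $S^dV$ are mutually perpendicular and $\langle x_1\cdots x_d\,|\,y_1\cdots y_d\rangle=\sum_{p}\prod_{j=1}^d\langle x_j|y_{p(j)}\rangle$ ($p$ running over all permutations of $\{1,\dots,d\}$). Let $SV'$ be the space of all antilinear functionals $SV\to\mathbb C$, and let the Fock space $S[V]$ be the Hilbert space completion of $SV$, identified with a subspace of $SV'$ by $\Phi\mapsto\langle\,\cdot\,|\Phi\rangle$. An antilinear map $Z:V\to V$ is symmetric if $\langle y|Zx\rangle=\langle x|Zy\rangle$ for all $x,y\in V$; in that case let $\zeta\in S^2V$ be the unique element with $\langle y|Zx\rangle=\langle xy|\zeta\rangle$ for all $x,y\in V$, and define the Gaussian $e^Z=\sum_{d\ge 0}\zeta^d/d!\in SV'$, that is, $e^Z(\theta)=\sum_{d\ge0}\langle\theta|\zeta^d\rangle/d!$ for $\theta\in SV$ (a finite sum). Let $\mathcal D(V)$ be the set of symmetric antilinear $Z$ with operator norm $\|Z\|<1$.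 Let $\mathcal G(V)$ be the set of complex-linear maps $T:V\to V$ with $\operatorname{Re}\langle v|Tv\rangle>0$ for all $v\neq 0$, and let $\mathrm{Det}^{1/2}:\mathcal G(V)\to\mathbb C$ be the holomorphic function with $(\mathrm{Det}^{1/2}(T))^2=\mathrm{Det}(T)$ for all $T \in \mathcal G(V)$ and $\mathrm{Det}^{1/2}(I)=1$. If $X,Y\in\mathcal D(V)$, then $e^X$ and $e^Y$ lie in $S[V]$, $I-YX$ lies in $\mathcal G(V)$, and $$\langle e^X\,|\,e^Y\rangle=\mathrm{Det}^{1/2}(I-YX)^{-1}.$$ -/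

import Mathlib

open scoped ComplexConjugate InnerProductSpace

namespace BosonicFock

section Polynomial

variable {σ : Type*}

/-- The bilinear pairing of polynomials in which the monomials are orthogonal and
`X ^ D` pairs with itself to `D! = ∏ i, (D i)!`. -/
noncomputable def polyPairing :
    MvPolynomial σ ℂ →ₗ[ℂ] MvPolynomial σ ℂ →ₗ[ℂ] ℂ :=
  (MvPolynomial.basisMonomials σ ℂ).constr ℂ
    fun D => (D.prod fun _ k => ((k.factorial : ℕ) : ℂ)) • MvPolynomial.lcoeff (R := ℂ) D

theorem polyPairing_monomial (D : σ →₀ ℕ) (a : ℂ) (q : MvPolynomial σ ℂ) :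
    polyPairing (MvPolynomial.monomial D a) q =
      a * ((D.prod fun _ k => ((k.factorial : ℕ) : ℂ)) * q.coeff D) := by
  have h : (MvPolynomial.monomial D a : MvPolynomial σ ℂ)
      = a • MvPolynomial.basisMonomials σ ℂ D := by
    simp [MvPolynomial.smul_monomial]
  rw [h, map_smul, polyPairing, Module.Basis.constr_basis]
  simp [MvPolynomial.lcoeff]

theorem polyPairing_X_mul (i : σ) (p q : MvPolynomial σ ℂ) :
    polyPairing (MvPolynomial.X i * p) q = polyPairing p (MvPolynomial.pderiv i q) := by
  classical
  induction p using MvPolynomial.induction_on' with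
  | add p₁ p₂ h₁ h₂ => simp [mul_add, h₁, h₂]
  | monomial D a =>
    have hX : (MvPolynomial.X i * MvPolynomial.monomial D a : MvPolynomial σ ℂ)
        = MvPolynomial.monomial (D + Finsupp.single i 1) a := by
      rw [MvPolynomial.X, MvPolynomial.monomial_mul, one_mul, add_comm]
    rw [hX, polyPairing_monomial, polyPairing_monomial, MvPolynomial.coeff_pderiv]
    have hf : ((D + Finsupp.single i 1).prod fun _ k => ((k.factorial : ℕ) : ℂ))
        = (D.prod fun _ k => ((k.factorial : ℕ) : ℂ)) * (D i + 1) := by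
      set s := insert i D.support with hs
      have h1 : (D + Finsupp.single i 1).support ⊆ s := by
        intro j hj
        by_cases hji : j = i
        · simp [hs, hji]
        · simp only [hs, Finset.mem_insert, Finsupp.mem_support_iff, Finsupp.add_apply] at hj ⊢
          rw [Finsupp.single_eq_of_ne hji] at hj
          right; simpa using hj
      rw [Finsupp.prod_of_support_subset _ h1 _ (by simp),
        Finsupp.prod_of_support_subset D (Finset.subset_insert i _) _ (by simp),
        ← Finset.mul_prod_erase s _ (Finset.mem_insert_self i _),
        ← Finset.mul_prod_erase s (fun j => (((D j).factorial : ℕ) : ℂ))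
          (Finset.mem_insert_self i _)]
      have h2 : ∀ j ∈ s.erase i, ((((D + Finsupp.single i 1 : σ →₀ ℕ) j).factorial : ℕ) : ℂ)
          = (((D j).factorial : ℕ) : ℂ) := by
        intro j hj
        rw [Finsupp.add_apply, Finsupp.single_eq_of_ne (Finset.ne_of_mem_erase hj), add_zero]
      rw [Finset.prod_congr rfl h2]
      simp only [Finsupp.add_apply, Finsupp.single_eq_same, Nat.factorial_succ]
      push_cast
      ring
    rw [hf]
    ring

theorem derivation_prod {A : Type*} [CommRing A] [Algebra ℂ A] (δ : Derivation ℂ A A)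
    {ι : Type*} [DecidableEq ι] (s : Finset ι) (f : ι → A) :
    δ (∏ j ∈ s, f j) = ∑ k ∈ s, δ (f k) * ∏ j ∈ s.erase k, f j := by
  induction s using Finset.induction_on with
  | empty => simp
  | insert a s ha ih =>
    rw [Finset.prod_insert ha, Derivation.leibniz, ih, Finset.sum_insert ha,
      Finset.erase_insert ha, smul_eq_mul, smul_eq_mul, Finset.mul_sum, add_comm, mul_comm]
    congr 1
    refine Finset.sum_congr rfl fun k hk => ?_
    have hka : a ≠ k := fun h => ha (h ▸ hk)
    rw [Finset.erase_insert_of_ne hka, Finset.prod_insert (by simp [ha])]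
    ring

theorem sum_perm_succ {d : ℕ} (M : Fin (d + 1) → Fin (d + 1) → ℂ) :
    ∑ p : Equiv.Perm (Fin (d + 1)), ∏ j, M j (p j) =
      ∑ k, M 0 k * ∑ p : Equiv.Perm (Fin d),
        ∏ j : Fin d, M j.succ (Equiv.swap 0 k (p j).succ) := by
  rw [← Equiv.Perm.decomposeFin.symm.sum_comp, Fintype.sum_prod_type]
  refine Finset.sum_congr rfl fun k _ => ?_
  rw [Finset.mul_sum]
  refine Finset.sum_congr rfl fun p _ => ?_
  rw [Fin.prod_univ_succ]
  simp

theorem prod_erase_swap {A : Type*} [CommRing A] {d : ℕ} (k : Fin (d + 1)) (f : Fin (d + 1) → A) :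
    ∏ j ∈ Finset.univ.erase k, f j = ∏ i : Fin d, f (Equiv.swap 0 k i.succ) := by
  symm
  refine Finset.prod_bij (fun i _ => Equiv.swap 0 k i.succ) ?_ ?_ ?_ ?_
  · intro i _
    simp only [Finset.mem_erase, Finset.mem_univ, and_true]
    intro h
    have := (Equiv.swap (0 : Fin (d + 1)) k).injective (h.trans (Equiv.swap_apply_left 0 k).symm)
    exact Fin.succ_ne_zero i this
  · intro i _ j _ h
    exact Fin.succ_injective _ ((Equiv.swap (0 : Fin (d + 1)) k).injective h)
  · intro j hj
    have hne : Equiv.swap 0 k j ≠ 0 := by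
      intro h
      have : j = k := by
        rw [← Equiv.swap_apply_self 0 k j, h, Equiv.swap_apply_left]
      simp [this] at hj
    obtain ⟨i, hi⟩ := Fin.exists_succ_eq.2 hne
    exact ⟨i, Finset.mem_univ _, by rw [hi, Equiv.swap_apply_self]⟩
  · intros; rfl

end Polynomial

section FockSpace

variable {V : Type*} [NormedAddCommGroup V] [InnerProductSpace ℂ V]

/-- Every element of `SV` is a linear combination of products of vectors. -/
theorem span_prod_eq_top : Submodule.span ℂ {θ : SymmetricAlgebra ℂ V |
    ∃ (d : ℕ) (x : Fin d → V), θ = ∏ j, SymmetricAlgebra.ι ℂ V (x j)} = ⊤ := by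
  rw [eq_top_iff]
  rintro θ -
  induction θ using SymmetricAlgebra.induction with
  | algebraMap r =>
    rw [Algebra.algebraMap_eq_smul_one]
    exact Submodule.smul_mem _ _ (Submodule.subset_span ⟨0, Fin.elim0, by simp⟩)
  | ι x => exact Submodule.subset_span ⟨1, fun _ => x, by simp⟩
  | add a b ha hb => exact Submodule.add_mem _ ha hb
  | mul a b ha hb =>
    have := Submodule.mul_mem_mul ha hb
    rw [Submodule.span_mul_span] at this
    refine Submodule.span_mono ?_ this
    rintro _ ⟨_, ⟨d, x, rfl⟩, _, ⟨e, y, rfl⟩, rfl⟩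
    exact ⟨d + e, Fin.append x y, by simp [Fin.prod_univ_add]⟩

variable [FiniteDimensional ℂ V]

/-- `SV` as a polynomial algebra in the coordinates of an orthonormal basis. -/
noncomputable def toPoly : SymmetricAlgebra ℂ V ≃ₐ[ℂ]
    MvPolynomial (Fin (Module.finrank ℂ V)) ℂ :=
  SymmetricAlgebra.equivMvPolynomial (stdOrthonormalBasis ℂ V).toBasis

theorem toPoly_ι (x : V) : toPoly (SymmetricAlgebra.ι ℂ V x) =
    ∑ i, MvPolynomial.C (⟪stdOrthonormalBasis ℂ V i, x⟫_ℂ) * MvPolynomial.X i := by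
  conv_lhs => rw [← (stdOrthonormalBasis ℂ V).sum_repr' x]
  rw [map_sum, map_sum]
  refine Finset.sum_congr rfl fun i _ => ?_
  rw [map_smul, map_smul, MvPolynomial.C_mul']
  congr 1
  have := SymmetricAlgebra.equivMvPolynomial_ι_apply (stdOrthonormalBasis ℂ V).toBasis i
  simpa [toPoly] using this

/-- The sesquilinear form on `SV` for which the monomials in an orthonormal basis are orthogonal
with squared norm `D!`. -/
noncomputable def coordInner :
    SymmetricAlgebra ℂ V →ₗ⋆[ℂ] SymmetricAlgebra ℂ V →ₗ[ℂ] ℂ :=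
  LinearMap.mk₂'ₛₗ (starRingEnd ℂ) (RingHom.id ℂ)
    (fun θ ψ => polyPairing (MvPolynomial.map (starRingEnd ℂ) (toPoly θ)) (toPoly ψ))
    (by intros; simp)
    (by
      intro c θ ψ
      rw [map_smul, ← MvPolynomial.C_mul', map_mul, MvPolynomial.map_C, MvPolynomial.C_mul',
        map_smul, LinearMap.smul_apply])
    (by intros; simp)
    (by intros; simp)

theorem coordInner_apply (θ ψ : SymmetricAlgebra ℂ V) : coordInner θ ψ =
    polyPairing (MvPolynomial.map (starRingEnd ℂ) (toPoly θ)) (toPoly ψ) := rfl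

/-- The annihilator of `x`: the derivation that sends `y` to `⟨x | y⟩`. -/
noncomputable def polyAnn (x : V) : Derivation ℂ (MvPolynomial (Fin (Module.finrank ℂ V)) ℂ)
    (MvPolynomial (Fin (Module.finrank ℂ V)) ℂ) :=
  ∑ i, ⟪x, stdOrthonormalBasis ℂ V i⟫_ℂ • MvPolynomial.pderiv i

theorem polyAnn_apply (x : V) (q : MvPolynomial (Fin (Module.finrank ℂ V)) ℂ) :
    polyAnn x q = ∑ i, ⟪x, stdOrthonormalBasis ℂ V i⟫_ℂ • MvPolynomial.pderiv i q := by
  have := congrFun (map_sum (Derivation.coeFnAddMonoidHom (R := ℂ)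
    (A := MvPolynomial (Fin (Module.finrank ℂ V)) ℂ)
    (M := MvPolynomial (Fin (Module.finrank ℂ V)) ℂ))
    (fun i => ⟪x, stdOrthonormalBasis ℂ V i⟫_ℂ • MvPolynomial.pderiv i) Finset.univ) q
  rw [Finset.sum_apply] at this
  exact this

theorem polyAnn_ι (x y : V) : polyAnn x (toPoly (SymmetricAlgebra.ι ℂ V y)) =
    MvPolynomial.C ⟪x, y⟫_ℂ := by
  classical
  rw [toPoly_ι, ← (stdOrthonormalBasis ℂ V).sum_inner_mul_inner x y, map_sum,
    map_sum]
  refine Finset.sum_congr rfl fun i _ => ?_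
  rw [polyAnn_apply, Finset.sum_eq_single i]
  · rw [MvPolynomial.pderiv_C_mul, MvPolynomial.pderiv_X_self, mul_one, map_mul,
      ← MvPolynomial.C_mul']
  · intro j _ hj
    rw [MvPolynomial.pderiv_C_mul, MvPolynomial.pderiv_X_of_ne hj.symm, mul_zero, smul_zero]
  · simp

theorem coordInner_ι_mul (x : V) (θ ψ : SymmetricAlgebra ℂ V) :
    coordInner (SymmetricAlgebra.ι ℂ V x * θ) ψ =
      polyPairing (MvPolynomial.map (starRingEnd ℂ) (toPoly θ)) (polyAnn x (toPoly ψ)) := by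
  rw [coordInner_apply, map_mul, map_mul, toPoly_ι, map_sum, Finset.sum_mul, map_sum,
    LinearMap.sum_apply, polyAnn_apply, map_sum]
  refine Finset.sum_congr rfl fun i _ => ?_
  rw [map_mul (MvPolynomial.map (starRingEnd ℂ)), MvPolynomial.map_C, MvPolynomial.map_X, mul_assoc, MvPolynomial.C_mul', map_smul,
    LinearMap.smul_apply, map_smul, polyPairing_X_mul, inner_conj_symm]

theorem coordInner_prod_zero {n : ℕ} (y : Fin (n + 1) → V) :
    coordInner 1 (∏ j, SymmetricAlgebra.ι ℂ V (y j)) = 0 := by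
  have h : ∀ q, polyPairing (1 : MvPolynomial (Fin (Module.finrank ℂ V)) ℂ) q
      = MvPolynomial.constantCoeff q := by
    intro q
    have := polyPairing_monomial (0 : (Fin (Module.finrank ℂ V)) →₀ ℕ) 1 q
    simpa [MvPolynomial.constantCoeff_eq] using this
  rw [coordInner_apply, map_one, map_one, h, Fin.prod_univ_succ, map_mul, map_mul, toPoly_ι]
  simp

theorem polyAnn_prod (x : V) {n : ℕ} (y : Fin (n + 1) → V) :
    polyAnn x (toPoly (∏ j, SymmetricAlgebra.ι ℂ V (y j))) =
      ∑ k, ⟪x, y k⟫_ℂ • toPoly (∏ i : Fin n,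
        SymmetricAlgebra.ι ℂ V (y (Equiv.swap 0 k i.succ))) := by
  rw [map_prod, derivation_prod]
  refine Finset.sum_congr rfl fun k _ => ?_
  rw [polyAnn_ι, prod_erase_swap, MvPolynomial.C_mul', map_prod]

theorem coordInner_prod {d : ℕ} (x y : Fin d → V) :
    coordInner (∏ j, SymmetricAlgebra.ι ℂ V (x j)) (∏ j, SymmetricAlgebra.ι ℂ V (y j)) =
      ∑ p : Equiv.Perm (Fin d), ∏ j, ⟪x j, y (p j)⟫_ℂ := by
  induction d with
  | zero =>
    have := polyPairing_monomial (0 : (Fin (Module.finrank ℂ V)) →₀ ℕ) 1 1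
    simpa [coordInner_apply] using this
  | succ d ih =>
    rw [Fin.prod_univ_succ, coordInner_ι_mul, polyAnn_prod, map_sum,
      sum_perm_succ (fun j k => ⟪x j, y k⟫_ℂ)]
    refine Finset.sum_congr rfl fun k _ => ?_
    rw [map_smul, ← coordInner_apply, ih, smul_eq_mul]

theorem coordInner_prod_ne {d e : ℕ} (hde : d ≠ e) (x : Fin d → V) (y : Fin e → V) :
    coordInner (∏ j, SymmetricAlgebra.ι ℂ V (x j)) (∏ j, SymmetricAlgebra.ι ℂ V (y j)) = 0 := by
  induction d generalizing e with
  | zero =>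
    obtain ⟨e, rfl⟩ := Nat.exists_eq_succ_of_ne_zero hde.symm
    simpa using coordInner_prod_zero y
  | succ d ih =>
    rw [Fin.prod_univ_succ, coordInner_ι_mul]
    cases e with
    | zero => simp
    | succ e =>
      rw [polyAnn_prod, map_sum]
      refine Finset.sum_eq_zero fun k _ => ?_
      rw [map_smul, ← coordInner_apply, ih (by omega), smul_zero]

theorem coordInner_eq_sum (θ ψ : SymmetricAlgebra ℂ V) : coordInner θ ψ =
    ∑ D ∈ (toPoly θ).support, conj ((toPoly θ).coeff D) *
      ((D.prod fun _ k => ((k.factorial : ℕ) : ℂ)) * (toPoly ψ).coeff D) := by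
  rw [coordInner_apply]
  conv_lhs => rw [MvPolynomial.as_sum (toPoly θ)]
  rw [map_sum, map_sum, LinearMap.sum_apply]
  refine Finset.sum_congr rfl fun D _ => ?_
  rw [MvPolynomial.map_monomial, polyPairing_monomial]

variable (V) in
/-- There is exactly one sesquilinear form on `SV` (antilinear in the first variable) for which
products of different degrees are perpendicular and
`⟨x₁ ⋯ x_d | y₁ ⋯ y_d⟩ = ∑ p, ∏ j, ⟨x_j | y_{p j}⟩`, the sum being over all permutations. -/
theorem existsUnique_symInner :
    ∃! B : SymmetricAlgebra ℂ V →ₗ⋆[ℂ] SymmetricAlgebra ℂ V →ₗ[ℂ] ℂ,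
      (∀ (d : ℕ) (x y : Fin d → V),
        B (∏ j, SymmetricAlgebra.ι ℂ V (x j)) (∏ j, SymmetricAlgebra.ι ℂ V (y j)) =
          ∑ p : Equiv.Perm (Fin d), ∏ j, ⟪x j, y (p j)⟫_ℂ) ∧
      (∀ (d e : ℕ), d ≠ e → ∀ (x : Fin d → V) (y : Fin e → V),
        B (∏ j, SymmetricAlgebra.ι ℂ V (x j)) (∏ j, SymmetricAlgebra.ι ℂ V (y j)) = 0) := by
  refine ⟨coordInner, ⟨fun _ => coordInner_prod, fun _ _ => coordInner_prod_ne⟩, ?_⟩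
  rintro B ⟨h1, h2⟩
  refine LinearMap.ext_on span_prod_eq_top ?_
  rintro _ ⟨d, x, rfl⟩
  refine LinearMap.ext_on span_prod_eq_top ?_
  rintro _ ⟨e, y, rfl⟩
  by_cases hde : d = e
  · subst hde
    rw [h1, coordInner_prod]
  · rw [h2 d e hde, coordInner_prod_ne hde]

variable (V) in
/-- The canonical inner product on the symmetric algebra. -/
noncomputable def symInner : SymmetricAlgebra ℂ V →ₗ⋆[ℂ] SymmetricAlgebra ℂ V →ₗ[ℂ] ℂ :=
  (existsUnique_symInner V).choose

theorem symInner_prod {d : ℕ} (x y : Fin d → V) :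
    symInner V (∏ j, SymmetricAlgebra.ι ℂ V (x j)) (∏ j, SymmetricAlgebra.ι ℂ V (y j)) =
      ∑ p : Equiv.Perm (Fin d), ∏ j, ⟪x j, y (p j)⟫_ℂ :=
  (existsUnique_symInner V).choose_spec.1.1 d x y

theorem symInner_prod_ne {d e : ℕ} (hde : d ≠ e) (x : Fin d → V) (y : Fin e → V) :
    symInner V (∏ j, SymmetricAlgebra.ι ℂ V (x j)) (∏ j, SymmetricAlgebra.ι ℂ V (y j)) = 0 :=
  (existsUnique_symInner V).choose_spec.1.2 d e hde x y

variable (V) in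
theorem symInner_eq_coordInner : symInner V = coordInner :=
  ((existsUnique_symInner V).choose_spec.2 coordInner
    ⟨fun _ => coordInner_prod, fun _ _ => coordInner_prod_ne⟩).symm

theorem symInner_conj (θ ψ : SymmetricAlgebra ℂ V) :
    conj (symInner V ψ θ) = symInner V θ ψ := by
  classical
  rw [symInner_eq_coordInner, coordInner_eq_sum, coordInner_eq_sum,
    Finset.sum_subset (Finset.subset_union_left (s₂ := (toPoly θ).support)),
    Finset.sum_subset (Finset.subset_union_right (s₁ := (toPoly ψ).support)
      (s₂ := (toPoly θ).support)), map_sum]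
  · refine Finset.sum_congr rfl fun D _ => ?_
    simp only [map_mul, Complex.conj_conj, Finsupp.prod, map_prod, Complex.conj_natCast]
    ring
  · intro D _ hD
    simp [MvPolynomial.notMem_support_iff.1 hD]
  · intro D _ hD
    simp [MvPolynomial.notMem_support_iff.1 hD]

theorem symInner_self (θ : SymmetricAlgebra ℂ V) : symInner V θ θ =
    ((∑ D ∈ (toPoly θ).support, (D.prod fun _ k => ((k.factorial : ℕ) : ℝ)) *
      ‖(toPoly θ).coeff D‖ ^ 2 : ℝ) : ℂ) := by
  rw [symInner_eq_coordInner, coordInner_eq_sum, Complex.ofReal_sum]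
  refine Finset.sum_congr rfl fun D _ => ?_
  rw [mul_left_comm, Complex.conj_mul']
  simp [Finsupp.prod]

variable (V) in
/-- The canonical inner product on `SV` satisfies the axioms of an inner product. -/
noncomputable abbrev symCore : InnerProductSpace.Core ℂ (SymmetricAlgebra ℂ V) where
  inner θ ψ := symInner V θ ψ
  conj_inner_symm θ ψ := symInner_conj θ ψ
  re_inner_nonneg θ := by
    rw [symInner_self]
    simp only [RCLike.re_to_complex, Complex.ofReal_re, Finsupp.prod]
    positivity
  add_left := by intros; simp
  smul_left := by intros; simp
  definite θ h := by
    rw [symInner_self, Complex.ofReal_eq_zero, Finset.sum_eq_zero_iff_of_nonneg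
      (fun D _ => by simp only [Finsupp.prod]; positivity)] at h
    have : toPoly θ = 0 := by
      by_contra hne
      obtain ⟨D, hD⟩ := MvPolynomial.support_nonempty.2 hne
      have h1 := h D hD
      have h2 : (D.prod fun _ k => ((k.factorial : ℕ) : ℝ)) ≠ 0 := by
        simp only [Finsupp.prod]
        exact Finset.prod_ne_zero_iff.2 fun i _ => by exact_mod_cast Nat.factorial_ne_zero _
      have h3 := (mul_eq_zero.1 h1).resolve_left h2
      exact (MvPolynomial.mem_support_iff.1 hD) (by simpa using h3)
    exact (map_eq_zero_iff toPoly toPoly.injective).1 this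

noncomputable instance symNormed : NormedAddCommGroup (SymmetricAlgebra ℂ V) :=
  (symCore V).toNormedAddCommGroup

noncomputable instance symInnerProductSpace : InnerProductSpace ℂ (SymmetricAlgebra ℂ V) :=
  InnerProductSpace.ofCore (symCore V).toCore

theorem inner_eq_symInner (θ ψ : SymmetricAlgebra ℂ V) : ⟪θ, ψ⟫_ℂ = symInner V θ ψ := rfl

variable (V) in
/-- Bosonic Fock space `S[V]`: the Hilbert space completion of `SV`. -/
abbrev Fock : Type _ := UniformSpace.Completion (SymmetricAlgebra ℂ V)

variable (V) in
/-- The full algebraic antidual `SV'`: all antilinear functionals on `SV`. -/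
abbrev Antidual : Type _ := SymmetricAlgebra ℂ V →ₗ⋆[ℂ] ℂ

variable (V) in
/-- The canonical map `S[V] → SV'`, `Φ ↦ ⟨· | Φ⟩`, identifying Fock space with a space of
antifunctionals. -/
noncomputable def Fock.toAntidual : Fock V →ₗ[ℂ] Antidual V :=
  ((innerₛₗ ℂ (E := Fock V)).comp
    (UniformSpace.Completion.toComplₗᵢ (𝕜 := ℂ) (E := SymmetricAlgebra ℂ V)).toLinearMap).flip

theorem Fock.toAntidual_apply (Φ : Fock V) (θ : SymmetricAlgebra ℂ V) :
    Fock.toAntidual V Φ θ = ⟪(θ : Fock V), Φ⟫_ℂ := rfl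

theorem Fock.toAntidual_injective : Function.Injective (Fock.toAntidual V) := by
  intro Φ Ψ h
  exact UniformSpace.Completion.denseRange_coe.eq_of_inner_right ℂ
    fun θ => LinearMap.congr_fun h θ

variable (V) in
/-- The homogeneous summand `S^d V` of the symmetric algebra. -/
noncomputable def symPower (d : ℕ) : Submodule ℂ (SymmetricAlgebra ℂ V) :=
  LinearMap.range (SymmetricAlgebra.ι ℂ V) ^ d

theorem symPower_le_span (n : ℕ) : symPower V n ≤ Submodule.span ℂ
    {θ : SymmetricAlgebra ℂ V | ∃ x : Fin n → V, θ = ∏ j, SymmetricAlgebra.ι ℂ V (x j)} := by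
  induction n with
  | zero =>
    rw [symPower, pow_zero, Submodule.one_eq_span]
    exact Submodule.span_mono (by rintro _ rfl; exact ⟨Fin.elim0, by simp⟩)
  | succ n ih =>
    rw [symPower, pow_succ']
    refine Submodule.mul_le.2 ?_
    rintro _ ⟨x, rfl⟩ ψ hψ
    have h := ih hψ
    clear hψ
    induction h using Submodule.span_induction with
    | mem ψ h =>
      obtain ⟨y, rfl⟩ := h
      exact Submodule.subset_span ⟨Fin.cons x y, by simp [Fin.prod_univ_succ]⟩
    | zero => simp
    | add a b _ _ ha hb => rw [mul_add]; exact Submodule.add_mem _ ha hb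
    | smul c a _ ha => rw [mul_smul_comm]; exact Submodule.smul_mem _ c ha

theorem symInner_prod_symPower {d n : ℕ} (h : d ≠ n) (x : Fin d → V) {ψ : SymmetricAlgebra ℂ V}
    (hψ : ψ ∈ symPower V n) : symInner V (∏ j, SymmetricAlgebra.ι ℂ V (x j)) ψ = 0 := by
  have := symPower_le_span n hψ
  clear hψ
  induction this using Submodule.span_induction with
  | mem ψ hψ => obtain ⟨y, rfl⟩ := hψ; exact symInner_prod_ne h x y
  | zero => simp
  | add a b _ _ ha hb => rw [map_add, ha, hb, add_zero]
  | smul c a _ ha => rw [map_smul, ha, smul_zero]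

/-- An antilinear map `Z : V → V` is symmetric if `⟨y | Z x⟩ = ⟨x | Z y⟩` for all `x, y`. -/
def IsSymmetricAntilinear (Z : V →L⋆[ℂ] V) : Prop := ∀ x y : V, ⟪y, Z x⟫_ℂ = ⟪x, Z y⟫_ℂ

variable (V) in
/-- The open Siegel domain `𝒟(V)`. -/
def siegelDomain : Set (V →L⋆[ℂ] V) := {Z | IsSymmetricAntilinear Z ∧ ‖Z‖ < 1}

theorem symInner_two (x y u v : V) :
    symInner V (SymmetricAlgebra.ι ℂ V x * SymmetricAlgebra.ι ℂ V y)
      (SymmetricAlgebra.ι ℂ V u * SymmetricAlgebra.ι ℂ V v) =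
      ⟪x, u⟫_ℂ * ⟪y, v⟫_ℂ + ⟪x, v⟫_ℂ * ⟪y, u⟫_ℂ := by
  have := symInner_prod ![x, y] ![u, v]
  rw [sum_perm_succ (fun j k => ⟪![x, y] j, ![u, v] k⟫_ℂ)] at this
  simpa [Fin.prod_univ_two, Fin.sum_univ_two] using this

/-- A symmetric antilinear map `Z` corresponds to a unique quadratic `ζ ∈ S²V`. -/
theorem existsUnique_quadratic {Z : V →L⋆[ℂ] V} (hZ : IsSymmetricAntilinear Z) :
    ∃! ζ : SymmetricAlgebra ℂ V, ζ ∈ symPower V 2 ∧ ∀ x y : V,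
      ⟪y, Z x⟫_ℂ = symInner V (SymmetricAlgebra.ι ℂ V x * SymmetricAlgebra.ι ℂ V y) ζ := by
  set b := stdOrthonormalBasis ℂ V
  have hmem : ∀ u v : V, SymmetricAlgebra.ι ℂ V u * SymmetricAlgebra.ι ℂ V v ∈ symPower V 2 := by
    intro u v
    rw [symPower, pow_two]
    exact Submodule.mul_mem_mul ⟨u, rfl⟩ ⟨v, rfl⟩
  set ξ := (2⁻¹ : ℂ) • ∑ k, SymmetricAlgebra.ι ℂ V (b k) * SymmetricAlgebra.ι ℂ V (Z (b k))
    with hξ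
  have hmemξ : ξ ∈ symPower V 2 :=
    Submodule.smul_mem _ _ (Submodule.sum_mem _ fun k _ => hmem _ _)
  have hspec : ∀ x y : V,
      ⟪y, Z x⟫_ℂ = symInner V (SymmetricAlgebra.ι ℂ V x * SymmetricAlgebra.ι ℂ V y) ξ := by
    intro x y
    have key : ∀ x y : V, ∑ k, ⟪x, b k⟫_ℂ * ⟪y, Z (b k)⟫_ℂ = ⟪y, Z x⟫_ℂ := by
      intro x y
      conv_rhs => rw [← b.sum_repr' x, map_sum, inner_sum]
      refine Finset.sum_congr rfl fun k _ => ?_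
      rw [map_smulₛₗ, inner_smul_right, inner_conj_symm]
    rw [hξ, map_smul, map_sum]
    simp only [symInner_two, Finset.sum_add_distrib]
    rw [key x y, Finset.sum_congr rfl fun k _ => mul_comm ⟪x, Z (b k)⟫_ℂ ⟪y, b k⟫_ℂ, key y x,
      hZ x y, smul_eq_mul]
    ring
  refine ⟨ξ, ⟨hmemξ, hspec⟩, ?_⟩
  rintro ζ ⟨hζ, hζZ⟩
  rw [← sub_eq_zero, ← inner_self_eq_zero (𝕜 := ℂ), inner_eq_symInner]
  have horth : ∀ θ ∈ symPower V 2, symInner V θ (ζ - ξ) = 0 := by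
    intro θ hθ
    rw [symPower, pow_two] at hθ
    induction hθ using Submodule.mul_induction_on' with
    | mem_mul_mem u hu v hv =>
      obtain ⟨x, rfl⟩ := hu
      obtain ⟨y, rfl⟩ := hv
      rw [map_sub, ← hζZ x y, ← hspec x y, sub_self]
    | add u _ v _ hu hv => rw [map_add, LinearMap.add_apply, hu, hv, add_zero]
  exact horth _ (Submodule.sub_mem _ hζ hmemξ)

/-- The quadratic `ζ ∈ S²V` with `⟨y | Z x⟩ = ⟨x y | ζ⟩` for all `x, y`. -/
noncomputable def quadratic (Z : V →L⋆[ℂ] V) (hZ : IsSymmetricAntilinear Z) :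
    SymmetricAlgebra ℂ V := (existsUnique_quadratic hZ).choose

theorem quadratic_mem (Z : V →L⋆[ℂ] V) (hZ : IsSymmetricAntilinear Z) :
    quadratic Z hZ ∈ symPower V 2 := (existsUnique_quadratic hZ).choose_spec.1.1

theorem symInner_quadratic (Z : V →L⋆[ℂ] V) (hZ : IsSymmetricAntilinear Z) (x y : V) :
    symInner V (SymmetricAlgebra.ι ℂ V x * SymmetricAlgebra.ι ℂ V y) (quadratic Z hZ) =
      ⟪y, Z x⟫_ℂ := ((existsUnique_quadratic hZ).choose_spec.1.2 x y).symm

/-- Each `θ ∈ SV` pairs nontrivially with only finitely many powers of a quadratic. -/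
theorem finite_symInner_pow {ζ : SymmetricAlgebra ℂ V} (hζ : ζ ∈ symPower V 2)
    (θ : SymmetricAlgebra ℂ V) : {d : ℕ | symInner V θ (ζ ^ d) ≠ 0}.Finite := by
  have hpow : ∀ d, ζ ^ d ∈ symPower V (2 * d) := by
    intro d
    rw [symPower, pow_mul]
    exact Submodule.pow_mem_pow _ hζ d
  have hθ : θ ∈ Submodule.span ℂ {θ : SymmetricAlgebra ℂ V |
    ∃ (d : ℕ) (x : Fin d → V), θ = ∏ j, SymmetricAlgebra.ι ℂ V (x j)} := by
    rw [span_prod_eq_top]; trivial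
  induction hθ using Submodule.span_induction with
  | mem θ h =>
    obtain ⟨n, x, rfl⟩ := h
    refine (Set.finite_le_nat n).subset fun d hd => ?_
    by_contra hlt
    exact hd (symInner_prod_symPower (by simp only [Set.mem_ofPred_eq] at hlt; omega) x (hpow d))
  | zero => simp
  | add a b _ _ ha hb =>
    refine (ha.union hb).subset fun d hd => ?_
    by_contra hn
    simp only [Set.mem_union, Set.mem_ofPred_eq, not_or, not_not] at hn
    exact hd (by rw [map_add, LinearMap.add_apply, hn.1, hn.2, add_zero])
  | smul c a _ ha =>
    refine ha.subset fun d hd h0 => hd ?_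
    rw [map_smulₛₗ, LinearMap.smul_apply, h0, smul_zero]

/-- The Gaussian `e^Z = ∑ d, ζ^d / d!` in `SV'`, where `ζ` is the quadratic corresponding to `Z`.
On each `θ ∈ SV` the sum has only finitely many nonzero terms. -/
noncomputable def gaussian (Z : V →L⋆[ℂ] V) (hZ : IsSymmetricAntilinear Z) : Antidual V where
  toFun θ := ∑ᶠ d : ℕ, ((d.factorial : ℕ) : ℂ)⁻¹ * symInner V θ (quadratic Z hZ ^ d)
  map_add' θ ψ := by
    have hfin : ∀ θ, (Function.support fun d : ℕ =>
        ((d.factorial : ℕ) : ℂ)⁻¹ * symInner V θ (quadratic Z hZ ^ d)).Finite := fun θ =>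
      (finite_symInner_pow (quadratic_mem Z hZ) θ).subset fun d hd => right_ne_zero_of_mul hd
    rw [← finsum_add_distrib (hfin θ) (hfin ψ)]
    simp [mul_add]
  map_smul' c θ := by
    rw [smul_eq_mul, ← smul_eq_mul, smul_finsum]
    simp [mul_left_comm]

theorem gaussian_apply (Z : V →L⋆[ℂ] V) (hZ : IsSymmetricAntilinear Z)
    (θ : SymmetricAlgebra ℂ V) : gaussian Z hZ θ =
      ∑ᶠ d : ℕ, ((d.factorial : ℕ) : ℂ)⁻¹ * symInner V θ (quadratic Z hZ ^ d) := rfl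

end FockSpace

section DetSqrt

/-- Complex matrices `A` with `Re (v* A v) > 0` for all `v ≠ 0`. -/
def IsAccretiveMatrix {n : ℕ} (A : Matrix (Fin n) (Fin n) ℂ) : Prop :=
  ∀ v : Fin n → ℂ, v ≠ 0 → 0 < (star v ⬝ᵥ A.mulVec v).re

theorem IsAccretiveMatrix.det_ne_zero {n : ℕ} {A : Matrix (Fin n) (Fin n) ℂ}
    (hA : IsAccretiveMatrix A) : A.det ≠ 0 := by
  intro h
  obtain ⟨v, hv, hv'⟩ := Matrix.exists_mulVec_eq_zero_iff.2 h
  have := hA v hv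
  simp [hv'] at this

theorem IsAccretiveMatrix.submatrix_succ {n : ℕ} {A : Matrix (Fin (n + 1)) (Fin (n + 1)) ℂ}
    (hA : IsAccretiveMatrix A) : IsAccretiveMatrix (A.submatrix Fin.succ Fin.succ) := by
  intro v hv
  have h := hA (Fin.cons 0 v) (by
    intro h
    apply hv
    funext i
    simpa using congrFun h i.succ)
  have e : (star (Fin.cons 0 v : Fin (n + 1) → ℂ) ⬝ᵥ A.mulVec (Fin.cons 0 v)) =
      star v ⬝ᵥ (A.submatrix Fin.succ Fin.succ).mulVec v := by
    simp [dotProduct, Matrix.mulVec, Fin.sum_univ_succ]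
  rwa [e] at h

theorem IsAccretiveMatrix.re_pivot_pos {n : ℕ} {A : Matrix (Fin (n + 1)) (Fin (n + 1)) ℂ}
    (hA : IsAccretiveMatrix A) :
    0 < (A.det / (A.submatrix Fin.succ Fin.succ).det).re := by
  have h0 := hA.submatrix_succ.det_ne_zero
  set w : Fin (n + 1) → ℂ := A.adjugate.mulVec (Pi.single 0 1) with hw
  have hw0 : w 0 = (A.submatrix Fin.succ Fin.succ).det := by
    rw [hw, Matrix.mulVec_single_one]
    simp [Matrix.col, Matrix.adjugate_fin_succ_eq_det_submatrix]
  have hAw : A.mulVec w = A.det • (Pi.single 0 1 : Fin (n + 1) → ℂ) := by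
    rw [hw, Matrix.mulVec_mulVec, Matrix.mul_adjugate, Matrix.smul_mulVec, Matrix.one_mulVec]
  have hpos := hA w (fun h => h0 (by rw [← hw0, h]; rfl))
  rw [hAw, dotProduct_smul, dotProduct_single_one, Pi.star_apply, hw0] at hpos
  set a := A.det
  set b := (A.submatrix Fin.succ Fin.succ).det
  have hb : 0 < Complex.normSq b := Complex.normSq_pos.2 h0
  rw [Complex.div_re, ← add_div]
  apply div_pos _ hb
  simpa using hpos

/-- The determinant has a holomorphic square root on accretive matrices, namely the product of the
principal square roots of the pivots. -/
theorem exists_matrix_detSqrt (E : Type*) [NormedAddCommGroup E] [NormedSpace ℂ E] (n : ℕ) :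
    ∃ F : Matrix (Fin n) (Fin n) ℂ → ℂ,
      (∀ A, IsAccretiveMatrix A → F A ^ 2 = A.det) ∧ F 1 = 1 ∧
      ∀ (s : Set E) (A : E → Matrix (Fin n) (Fin n) ℂ),
        (∀ i j, DifferentiableOn ℂ (fun t => A t i j) s) →
        (∀ t ∈ s, IsAccretiveMatrix (A t)) → DifferentiableOn ℂ (fun t => F (A t)) s := by
  induction n with
  | zero =>
    exact ⟨fun _ => 1, fun A _ => by simp, rfl, fun s A _ _ => differentiableOn_const _⟩
  | succ n ih =>
    obtain ⟨F, hF, hF1, hFd⟩ := ih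
    refine ⟨fun A => (A.det / (A.submatrix Fin.succ Fin.succ).det) ^ (((2 : ℕ) : ℂ)⁻¹) *
      F (A.submatrix Fin.succ Fin.succ), ?_, ?_, ?_⟩
    · intro A hA
      rw [mul_pow, hF _ hA.submatrix_succ, Complex.cpow_nat_inv_pow _ two_ne_zero,
        div_mul_cancel₀ _ hA.submatrix_succ.det_ne_zero]
    · have : ((1 : Matrix (Fin (n + 1)) (Fin (n + 1)) ℂ).submatrix Fin.succ Fin.succ) = 1 :=
        Matrix.submatrix_one _ (Fin.succ_injective _)
      simp [this, hF1]
    · intro s A hd hA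
      have hdet : ∀ (m : ℕ) (M : E → Matrix (Fin m) (Fin m) ℂ),
          (∀ i j, DifferentiableOn ℂ (fun t => M t i j) s) →
          DifferentiableOn ℂ (fun t => (M t).det) s := by
        intro m M hM
        simp only [Matrix.det_apply]
        refine DifferentiableOn.fun_sum fun σ _ => ?_
        refine DifferentiableOn.fun_const_smul ?_ _
        have hprod : ∀ u : Finset (Fin m),
            DifferentiableOn ℂ (fun t => ∏ i ∈ u, M t (σ i) i) s := by
          intro u
          induction u using Finset.induction_on with
          | empty => simp
          | insert a u ha ih => simpa [Finset.prod_insert ha] using (hM _ _).fun_mul ih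
        exact hprod _
      refine DifferentiableOn.mul ?_ (hFd s _ (fun i j => hd _ _) fun t ht => (hA t ht).submatrix_succ)
      refine DifferentiableOn.cpow ?_ (differentiableOn_const _) ?_
      · simp only [div_eq_mul_inv]
        exact (hdet _ A hd).fun_mul
          ((hdet _ (fun t => (A t).submatrix Fin.succ Fin.succ) fun i j => hd _ _).fun_inv
            fun t ht => (hA t ht).submatrix_succ.det_ne_zero)
      · intro t ht
        exact Or.inl (hA t ht).re_pivot_pos

variable (V : Type*) [NormedAddCommGroup V] [InnerProductSpace ℂ V]

/-- The set `𝒢(V)` of complex-linear maps `T` with `Re ⟨v | T v⟩ > 0` for all `v ≠ 0`. -/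
def accretive : Set (V →L[ℂ] V) := {T | ∀ v : V, v ≠ 0 → 0 < (⟪v, T v⟫_ℂ).re}

variable [FiniteDimensional ℂ V]

theorem exists_detSqrt : ∃ f : (V →L[ℂ] V) → ℂ,
    DifferentiableOn ℂ f (accretive V) ∧ (∀ T ∈ accretive V, f T ^ 2 = T.det) ∧ f 1 = 1 := by
  obtain ⟨F, hF, hF1, hFd⟩ := exists_matrix_detSqrt (V →L[ℂ] V) (Module.finrank ℂ V)
  set b := stdOrthonormalBasis ℂ V with hb
  have hent : ∀ (T : V →L[ℂ] V) i j,
      LinearMap.toMatrix b.toBasis b.toBasis (T : V →ₗ[ℂ] V) i j = ⟪b i, T (b j)⟫_ℂ := by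
    intro T i j
    simp [LinearMap.toMatrix_apply, OrthonormalBasis.repr_apply_apply]
  have hacc : ∀ T ∈ accretive V,
      IsAccretiveMatrix (LinearMap.toMatrix b.toBasis b.toBasis (T : V →ₗ[ℂ] V)) := by
    intro T hT v hv
    have hne : ∑ i, v i • b i ≠ 0 := by
      intro h
      apply hv
      funext i
      exact Fintype.linearIndependent_iff.1 b.toBasis.linearIndependent v (by simpa using h) i
    have h := hT _ hne
    have e : ⟪∑ i, v i • b i, T (∑ i, v i • b i)⟫_ℂ =
        star v ⬝ᵥ (LinearMap.toMatrix b.toBasis b.toBasis (T : V →ₗ[ℂ] V)).mulVec v := by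
      simp only [map_sum, map_smul, sum_inner, inner_sum, inner_smul_left, inner_smul_right,
        dotProduct, Matrix.mulVec, hent, Finset.mul_sum, Pi.star_apply]
      rw [Finset.sum_comm]
      refine Finset.sum_congr rfl fun i _ => Finset.sum_congr rfl fun j _ => ?_
      simp only [RCLike.star_def]
      ring
    rwa [e] at h
  refine ⟨fun T => F (LinearMap.toMatrix b.toBasis b.toBasis (T : V →ₗ[ℂ] V)), ?_, ?_, ?_⟩
  · refine hFd _ (fun T => LinearMap.toMatrix b.toBasis b.toBasis (T : V →ₗ[ℂ] V)) ?_ hacc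
    intro i j
    simp only [hent]
    have : (fun T : V →L[ℂ] V => ⟪b i, T (b j)⟫_ℂ) =
        fun T => ((innerSL ℂ (b i)).comp (ContinuousLinearMap.apply ℂ V (b j))) T := by
      funext T; simp
    rw [this]
    exact ContinuousLinearMap.differentiableOn _
  · intro T hT
    change F _ ^ 2 = _
    rw [hF _ (hacc T hT), LinearMap.det_toMatrix]
  · change F _ = 1
    rw [ContinuousLinearMap.toLinearMap_one, LinearMap.toMatrix_one, hF1]

/-- `Det^{1/2}`: the holomorphic square root of the determinant on `accretive V` that takes the
value `1` at the identity. -/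
noncomputable def detSqrt : (V →L[ℂ] V) → ℂ := (exists_detSqrt V).choose

theorem detSqrt_spec : DifferentiableOn ℂ (detSqrt V) (accretive V) ∧
    (∀ T ∈ accretive V, detSqrt V T ^ 2 = T.det) ∧ detSqrt V 1 = 1 :=
  (exists_detSqrt V).choose_spec

/-- The defining properties determine `detSqrt` on `accretive V`. -/
theorem detSqrt_unique (f : (V →L[ℂ] V) → ℂ) (hf : DifferentiableOn ℂ f (accretive V))
    (hf2 : ∀ T ∈ accretive V, f T ^ 2 = T.det) (hf1 : f 1 = 1) :
    Set.EqOn f (detSqrt V) (accretive V) := by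
  obtain ⟨h1, h2, h3⟩ := detSqrt_spec V
  have hconv : Convex ℝ (accretive V) := by
    intro S hS T hT a b ha hb hab v hv
    have e : (⟪v, (a • S + b • T) v⟫_ℂ).re = a * (⟪v, S v⟫_ℂ).re + b * (⟪v, T v⟫_ℂ).re := by
      simp [inner_smul_right_eq_smul]
    rw [e]
    have hs := hS v hv
    have ht := hT v hv
    rcases ha.eq_or_lt with rfl | ha
    · have : b = 1 := by linarith
      subst this; linarith
    · have := mul_pos ha hs
      have := mul_nonneg hb ht.le
      linarith
  have hone : (1 : V →L[ℂ] V) ∈ accretive V := by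
    intro v hv
    have : 0 < ‖v‖ ^ 2 := by positivity
    simpa [inner_self_eq_norm_sq_to_K, ← Complex.ofReal_pow] using this
  refine hconv.isPreconnected.eq_of_sq_eq hf.continuousOn h1.continuousOn ?_ ?_ hone
    (hf1.trans h3.symm)
  · intro T hT
    simp [hf2 T hT, h2 T hT]
  · intro T hT h0
    have hdet : LinearMap.det (T : V →ₗ[ℂ] V) = 0 := by
      have := h2 T hT
      rw [h0] at this
      simpa using this.symm
    obtain ⟨v, hv, hv0⟩ := (Submodule.ne_bot_iff _).1
      (bot_lt_iff_ne_bot.1 (LinearMap.bot_lt_ker_of_det_eq_zero hdet))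
    have hTv : T v = 0 := hv
    have := hT v hv0
    simp [hTv] at this

end DetSqrt

end BosonicFock

/-! Write `g_Z(d) = ζ^d / d!` (`gaussianTerm`), `a m = ⟨g_X(m) | g_Y(m)⟩` and `T = YX`. The proof
identifies the generating function `∑ z^m a m` with `Det^{1/2}(1 - zT)⁻¹` by showing that their
coefficients obey the same recursion.

Algebraic side: multiplication by a vector `x` is adjoint to a derivation `ann x`, and `ann x` sends
`ζ` to `Zx`. Hence the adjoint of multiplication by the quadratic of `U`, applied to `g_Y(m+2)`,
yields the quadratic of `YUY` times `g_Y(m)`, plus `½ tr(YU) g_Y(m+1)`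
(`symInner_basisQuadratic_mul_gaussianTerm`). Moving quadratics back and forth between the two sides
of the inner product emits one trace of a power of `T` at each step, which gives `(m+1) a(m+1) = ½ ∑
k ≤ m, tr(T^(k+1)) a(m-k)` (`symInner_gaussianTerm_succ`).

Analytic side: by Jacobi's formula `φ(z) = Det^{1/2}(1 - zT)⁻¹` solves `φ' = ½ tr(T(1 - zT)⁻¹) φ`.
The Neumann series turns this into the same recursion (`hasSum_inv_detSqrt`).

Since `‖T‖ < 1`, the expansion holds on a disc of radius greater than 1. Evaluating at `z = 1` gives
the inner product; for `X = Y`, convergence at some `s > 1` puts the Gaussian in Fock space. -/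

namespace BosonicFock

/-! ### Annihilation operators and the recursion for inner products of Gaussian components. -/

section Annihilation

variable {V : Type*} [NormedAddCommGroup V] [InnerProductSpace ℂ V] [FiniteDimensional ℂ V]

/-- The annihilator of `x`: the derivation of `SV` that sends `ι y` to `⟨x | y⟩`. -/
noncomputable def ann (x : V) :
    Derivation ℂ (SymmetricAlgebra ℂ V) (SymmetricAlgebra ℂ V) :=
  Derivation.mk'
    (toPoly.symm.toLinearMap ∘ₗ (polyAnn x).toLinearMap ∘ₗ toPoly.toLinearMap) fun a b => by
      simp [map_add]

theorem ann_apply (x : V) (θ : SymmetricAlgebra ℂ V) :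
    ann x θ = toPoly.symm (polyAnn x (toPoly θ)) := rfl

theorem ann_ι (x y : V) : ann x (SymmetricAlgebra.ι ℂ V y) = algebraMap ℂ _ ⟪x, y⟫_ℂ := by
  rw [ann_apply, polyAnn_ι, ← MvPolynomial.algebraMap_eq, AlgEquiv.commutes]

/-- Annihilation by `x` is adjoint to multiplication by `x`. -/
theorem symInner_ι_mul (x : V) (θ ψ : SymmetricAlgebra ℂ V) :
    symInner V (SymmetricAlgebra.ι ℂ V x * θ) ψ = symInner V θ (ann x ψ) := by
  rw [symInner_eq_coordInner, coordInner_ι_mul, coordInner_apply, ann_apply,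
    AlgEquiv.apply_symm_apply]

/-- The quadratic `½ ∑ k, b k * Z (b k)` attached to an antilinear map `Z`, where `b` is an
orthonormal basis. -/
noncomputable def basisQuadratic (Z : V →L⋆[ℂ] V) : SymmetricAlgebra ℂ V :=
  (2⁻¹ : ℂ) • ∑ k, SymmetricAlgebra.ι ℂ V (stdOrthonormalBasis ℂ V k) *
    SymmetricAlgebra.ι ℂ V (Z (stdOrthonormalBasis ℂ V k))

theorem sum_inner_smul_map (Z : V →L⋆[ℂ] V) (x : V) :
    ∑ k, ⟪x, stdOrthonormalBasis ℂ V k⟫_ℂ • Z (stdOrthonormalBasis ℂ V k) = Z x := by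
  conv_rhs => rw [← (stdOrthonormalBasis ℂ V).sum_repr' x, map_sum]
  refine Finset.sum_congr rfl fun k _ => ?_
  rw [map_smulₛₗ, inner_conj_symm]

/-- The Leibniz rule gives two sums. One is `Z x` by antilinearity, the other by symmetry of `Z`;
the factor `½` absorbs the doubling. -/
theorem ann_basisQuadratic {Z : V →L⋆[ℂ] V} (hZ : IsSymmetricAntilinear Z) (x : V) :
    ann x (basisQuadratic Z) = SymmetricAlgebra.ι ℂ V (Z x) := by
  have h1 : ∑ k, ⟪x, Z (stdOrthonormalBasis ℂ V k)⟫_ℂ • stdOrthonormalBasis ℂ V k = Z x := by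
    conv_rhs => rw [← (stdOrthonormalBasis ℂ V).sum_repr' (Z x)]
    exact Finset.sum_congr rfl fun k _ => by rw [hZ]
  rw [basisQuadratic, Derivation.map_smul, map_sum]
  simp only [Derivation.leibniz, ann_ι, smul_eq_mul, Finset.sum_add_distrib]
  simp only [mul_comm _ (algebraMap ℂ (SymmetricAlgebra ℂ V) _), ← Algebra.smul_def, ← map_smul,
    ← map_sum]
  rw [h1, sum_inner_smul_map, ← two_smul ℂ, smul_smul]
  norm_num

theorem basisQuadratic_mem (Z : V →L⋆[ℂ] V) : basisQuadratic Z ∈ symPower V 2 := by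
  rw [symPower, pow_two]
  exact Submodule.smul_mem _ _ (Submodule.sum_mem _ fun k _ =>
    Submodule.mul_mem_mul ⟨_, rfl⟩ ⟨_, rfl⟩)

/-- Replaces the quadratic known only through its defining property by an explicit sum on which
derivations can be computed. -/
theorem quadratic_eq_basisQuadratic (Z : V →L⋆[ℂ] V) (hZ : IsSymmetricAntilinear Z) :
    quadratic Z hZ = basisQuadratic Z := by
  refine (existsUnique_quadratic hZ).unique (existsUnique_quadratic hZ).choose_spec.1
    ⟨basisQuadratic_mem Z, fun x y => ?_⟩
  rw [symInner_ι_mul, ann_basisQuadratic hZ]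
  simpa using (symInner_prod ![y] ![Z x]).symm

/-- The matrix of `Y` in an orthonormal basis is symmetric, so `Y` can be moved from one factor to
the other in a sum over the basis. -/
theorem sum_ι_mul_ι_comp {Y : V →L⋆[ℂ] V} (hY : IsSymmetricAntilinear Y) (T : V →L[ℂ] V) :
    ∑ k, SymmetricAlgebra.ι ℂ V (Y (stdOrthonormalBasis ℂ V k)) *
        SymmetricAlgebra.ι ℂ V (T (stdOrthonormalBasis ℂ V k)) =
      ∑ k, SymmetricAlgebra.ι ℂ V (stdOrthonormalBasis ℂ V k) *
        SymmetricAlgebra.ι ℂ V (T (Y (stdOrthonormalBasis ℂ V k))) := by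
  set b := stdOrthonormalBasis ℂ V with hb
  have h1 : ∀ k, Y (b k) = ∑ j, ⟪b j, Y (b k)⟫_ℂ • b j := fun k => (b.sum_repr' _).symm
  have h2 : ∀ j, T (Y (b j)) = ∑ k, ⟪b j, Y (b k)⟫_ℂ • T (b k) := fun j => by
    conv_lhs => rw [h1 j, map_sum]
    exact Finset.sum_congr rfl fun k _ => by rw [map_smul, hY]
  simp only [h2]
  conv_lhs => enter [2, k]; rw [h1 k]
  simp only [map_sum, map_smul, Finset.sum_mul, Finset.mul_sum, smul_mul_assoc, mul_smul_comm]
  exact Finset.sum_comm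

/-- The homogeneous component `ζ ^ d / d!` of the Gaussian of `Z`. -/
noncomputable def gaussianTerm (Z : V →L⋆[ℂ] V) (d : ℕ) : SymmetricAlgebra ℂ V :=
  ((d.factorial : ℕ) : ℂ)⁻¹ • basisQuadratic Z ^ d

theorem gaussianTerm_zero (Z : V →L⋆[ℂ] V) : gaussianTerm Z 0 = 1 := by
  simp [gaussianTerm]

theorem basisQuadratic_mul_gaussianTerm (Z : V →L⋆[ℂ] V) (d : ℕ) :
    basisQuadratic Z * gaussianTerm Z d = ((d : ℂ) + 1) • gaussianTerm Z (d + 1) := by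
  have : ((d : ℂ) + 1) ≠ 0 := by exact_mod_cast d.succ_ne_zero
  rw [gaussianTerm, gaussianTerm, mul_smul_comm, ← pow_succ', smul_smul, Nat.factorial_succ]
  congr 1
  push_cast
  field_simp

theorem gaussianTerm_mem (Z : V →L⋆[ℂ] V) (d : ℕ) : gaussianTerm Z d ∈ symPower V (2 * d) := by
  rw [symPower, pow_mul]
  exact Submodule.smul_mem _ _ (Submodule.pow_mem_pow _ (basisQuadratic_mem Z) d)

theorem ann_gaussianTerm_succ {Z : V →L⋆[ℂ] V} (hZ : IsSymmetricAntilinear Z) (x : V) (d : ℕ) :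
    ann x (gaussianTerm Z (d + 1)) = SymmetricAlgebra.ι ℂ V (Z x) * gaussianTerm Z d := by
  have : ((d : ℂ) + 1) ≠ 0 := by exact_mod_cast d.succ_ne_zero
  rw [gaussianTerm, gaussianTerm, Derivation.map_smul, Derivation.leibniz_pow, ann_basisQuadratic hZ,
    Nat.add_sub_cancel, smul_eq_mul, mul_smul_comm, mul_comm (_ ^ d), ← Nat.cast_smul_eq_nsmul ℂ,
    smul_smul, Nat.factorial_succ]
  congr 1
  push_cast
  field_simp

/-- The order of the two annihilators is chosen for Gaussians: annihilating by `U (b k)` first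
brings out the vector `Y (U (b k))`, on which `b k` then yields a diagonal entry of `YU`, hence a
trace. -/
theorem symInner_basisQuadratic_mul (U : V →L⋆[ℂ] V) (θ ψ : SymmetricAlgebra ℂ V) :
    symInner V (basisQuadratic U * θ) ψ = symInner V θ ((2⁻¹ : ℂ) •
      ∑ k, ann (stdOrthonormalBasis ℂ V k) (ann (U (stdOrthonormalBasis ℂ V k)) ψ)) := by
  rw [basisQuadratic, smul_mul_assoc, Finset.sum_mul, map_smulₛₗ, LinearMap.smul_apply, map_smul,
    map_sum, map_sum, LinearMap.sum_apply]
  congr 1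
  · rw [map_inv₀, map_ofNat]
  · refine Finset.sum_congr rfl fun k _ => ?_
    rw [mul_comm (SymmetricAlgebra.ι ℂ V _), mul_assoc, symInner_ι_mul, symInner_ι_mul]

theorem trace_eq_sum_inner_basis (T : V →L[ℂ] V) :
    LinearMap.trace ℂ V (T : V →ₗ[ℂ] V) =
      ∑ k, ⟪stdOrthonormalBasis ℂ V k, T (stdOrthonormalBasis ℂ V k)⟫_ℂ :=
  LinearMap.trace_eq_sum_inner _ (stdOrthonormalBasis ℂ V)

/-- The lowest degree, where both annihilations exhaust the quadratic and only the trace term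
survives. -/
theorem symInner_basisQuadratic_mul_gaussianTerm_one {Y : V →L⋆[ℂ] V}
    (hY : IsSymmetricAntilinear Y) (U : V →L⋆[ℂ] V) (θ : SymmetricAlgebra ℂ V) :
    symInner V (basisQuadratic U * θ) (gaussianTerm Y 1) =
      2⁻¹ * LinearMap.trace ℂ V ((Y.comp U : V →L[ℂ] V) : V →ₗ[ℂ] V) *
        symInner V θ (gaussianTerm Y 0) := by
  rw [symInner_basisQuadratic_mul, trace_eq_sum_inner_basis, ← smul_eq_mul, ← map_smul]
  congr 1
  simp only [ann_gaussianTerm_succ hY, gaussianTerm_zero, mul_one, ann_ι]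
  rw [← map_sum, Algebra.algebraMap_eq_smul_one, smul_smul]
  rfl

/-- The adjoint of multiplication by a quadratic, applied to the components of a Gaussian. -/
theorem symInner_basisQuadratic_mul_gaussianTerm {Y : V →L⋆[ℂ] V}
    (hY : IsSymmetricAntilinear Y) (U : V →L⋆[ℂ] V) (θ : SymmetricAlgebra ℂ V) (m : ℕ) :
    symInner V (basisQuadratic U * θ) (gaussianTerm Y (m + 2)) =
      symInner V θ (basisQuadratic ((Y.comp U : V →L[ℂ] V).comp Y) * gaussianTerm Y m) +
      2⁻¹ * LinearMap.trace ℂ V ((Y.comp U : V →L[ℂ] V) : V →ₗ[ℂ] V) *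
        symInner V θ (gaussianTerm Y (m + 1)) := by
  rw [symInner_basisQuadratic_mul, trace_eq_sum_inner_basis, ← smul_eq_mul (_ * _), ← map_smul, ← map_add]
  congr 1
  simp only [ann_gaussianTerm_succ hY, Derivation.leibniz, ann_ι, smul_eq_mul,
    Finset.sum_add_distrib]
  -- The outer annihilator also hits the remaining Gaussian factor, leaving products of `Y (b k)`
  -- and `Y (U (b k))`. Symmetry of `Y` recasts their sum as the quadratic of `YUY`.
  have h := sum_ι_mul_ι_comp hY (Y.comp U : V →L[ℂ] V)
  simp only [ContinuousLinearMap.comp_apply] at h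
  rw [smul_add, basisQuadratic]
  congr 1
  · simp only [ContinuousLinearMap.comp_apply]
    rw [← h, smul_mul_assoc, Finset.sum_mul]
    congr 1
    exact Finset.sum_congr rfl fun k _ => by ring
  · rw [← Finset.mul_sum, ← map_sum, mul_comm, ← Algebra.smul_def, smul_smul]
    rfl

/-- Moving an antilinear map cyclically inside a trace conjugates the trace. This matches the two
trace terms when an adjoint formula is read with the sides exchanged. -/
theorem conj_trace_comp (X Y : V →L⋆[ℂ] V) :
    conj (LinearMap.trace ℂ V ((X.comp Y : V →L[ℂ] V) : V →ₗ[ℂ] V)) =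
      LinearMap.trace ℂ V ((Y.comp X : V →L[ℂ] V) : V →ₗ[ℂ] V) := by
  have h : ∀ A B : V →L⋆[ℂ] V, ∀ k, ⟪stdOrthonormalBasis ℂ V k,
      A (B (stdOrthonormalBasis ℂ V k))⟫_ℂ = ∑ j, conj ⟪stdOrthonormalBasis ℂ V j,
        B (stdOrthonormalBasis ℂ V k)⟫_ℂ *
          ⟪stdOrthonormalBasis ℂ V k, A (stdOrthonormalBasis ℂ V j)⟫_ℂ := fun A B k => by
    rw [← sum_inner_smul_map A, inner_sum]
    exact Finset.sum_congr rfl fun j _ => by rw [inner_smul_right, inner_conj_symm]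
  simp only [trace_eq_sum_inner_basis, map_sum, ContinuousLinearMap.comp_apply, h, map_mul,
    Complex.conj_conj]
  rw [Finset.sum_comm]
  exact Finset.sum_congr rfl fun j _ => Finset.sum_congr rfl fun k _ => mul_comm _ _

/-- Quadratics built from `Y (X Y)^j` on the right and from `X (Y X)^j` on the left have the same
matrix elements between Gaussians. -/
theorem symInner_gaussianTerm_basisQuadratic_mul {X Y : V →L⋆[ℂ] V}
    (hX : IsSymmetricAntilinear X) (hY : IsSymmetricAntilinear Y) (j m : ℕ) :
    symInner V (gaussianTerm X (m + 1))
        (basisQuadratic (((Y.comp X : V →L[ℂ] V) ^ j).comp Y) * gaussianTerm Y m) =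
      symInner V (basisQuadratic (X.comp ((Y.comp X : V →L[ℂ] V) ^ j)) * gaussianTerm X m)
        (gaussianTerm Y (m + 1)) := by
  induction j generalizing m with
  | zero =>
    have h1 : ((Y.comp X : V →L[ℂ] V) ^ 0).comp Y = Y := by ext; simp
    have h2 : X.comp ((Y.comp X : V →L[ℂ] V) ^ 0) = X := by ext; simp
    rw [h1, h2, basisQuadratic_mul_gaussianTerm, basisQuadratic_mul_gaussianTerm, map_smul,
      map_smulₛₗ, LinearMap.smul_apply]
    simp
  | succ j ih =>
    set T : V →L[ℂ] V := Y.comp X with hT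
    -- One adjoint formula moves a quadratic from left to right, the other, after conjugation, from
    -- right to left. Their left-hand sides agree by the induction hypothesis at `m + 1`, and both
    -- trace terms are `½ tr(T^(j+1)) a(m+1)`, so the remaining terms agree.
    have hU := symInner_basisQuadratic_mul_gaussianTerm hY (X.comp (T ^ j)) (gaussianTerm X (m + 1)) m
    have hW := symInner_basisQuadratic_mul_gaussianTerm hX ((T ^ j).comp Y) (gaussianTerm Y (m + 1)) m
    have e1 : (Y.comp (X.comp (T ^ j)) : V →L[ℂ] V).comp Y = (T ^ (j + 1)).comp Y := by
      rw [pow_succ']; rfl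
    have e2 : (X.comp ((T ^ j).comp Y) : V →L[ℂ] V).comp X = X.comp (T ^ (j + 1)) := by
      rw [pow_succ]; rfl
    have e3 : (Y.comp (X.comp (T ^ j)) : V →L[ℂ] V) = T ^ (j + 1) := by rw [pow_succ']; rfl
    have e4 : (((T ^ j).comp Y).comp X : V →L[ℂ] V) = T ^ (j + 1) := by rw [pow_succ]; rfl
    have hW' := congrArg conj hW
    rw [map_add, map_mul (starRingEnd ℂ), map_mul (starRingEnd ℂ), symInner_conj, symInner_conj,
      symInner_conj, conj_trace_comp, e2, e4, map_inv₀, map_ofNat, ih (m + 1)] at hW'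
    rw [e1, e3, hW'] at hU
    exact (add_right_cancel hU).symm

/-- The inner products of the homogeneous components of two Gaussians satisfy the recursion of the
Taylor coefficients of `Det (1 - z Y X) ^ (-1/2)`. -/
theorem symInner_gaussianTerm_succ {X Y : V →L⋆[ℂ] V}
    (hX : IsSymmetricAntilinear X) (hY : IsSymmetricAntilinear Y) (m : ℕ) :
    ((m : ℂ) + 1) * symInner V (gaussianTerm X (m + 1)) (gaussianTerm Y (m + 1)) =
      2⁻¹ * ∑ k ∈ Finset.range (m + 1),
        LinearMap.trace ℂ V (((Y.comp X : V →L[ℂ] V) ^ (k + 1) : V →L[ℂ] V) : V →ₗ[ℂ] V) *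
          symInner V (gaussianTerm X (m - k)) (gaussianTerm Y (m - k)) := by
  set T : V →L[ℂ] V := Y.comp X with hT
  have e1 : ∀ j, (Y.comp (X.comp (T ^ j)) : V →L[ℂ] V).comp Y = (T ^ (j + 1)).comp Y := fun j => by
    rw [pow_succ']; rfl
  have e3 : ∀ j, (Y.comp (X.comp (T ^ j)) : V →L[ℂ] V) = T ^ (j + 1) := fun j => by
    rw [pow_succ']; rfl
  -- The exponent `j` is kept general so that induction on `m` closes: each step lowers `m`, raises
  -- `j` and splits off the `k = 0` summand. The recursion is the case `j = 0`, where the quadratic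
  -- of `X` times `g_X(m)` is `(m+1) g_X(m+1)`.
  have key : ∀ m j, symInner V (basisQuadratic (X.comp (T ^ j)) * gaussianTerm X m)
      (gaussianTerm Y (m + 1)) = 2⁻¹ * ∑ k ∈ Finset.range (m + 1),
        LinearMap.trace ℂ V ((T ^ (j + k + 1) : V →L[ℂ] V) : V →ₗ[ℂ] V) *
          symInner V (gaussianTerm X (m - k)) (gaussianTerm Y (m - k)) := by
    intro m
    induction m with
    | zero =>
      intro j
      rw [symInner_basisQuadratic_mul_gaussianTerm_one hY, e3]
      simp [mul_assoc]
    | succ m ih =>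
      intro j
      rw [symInner_basisQuadratic_mul_gaussianTerm hY, e1, e3,
        symInner_gaussianTerm_basisQuadratic_mul hX hY, ← hT, ih, Finset.sum_range_succ' _ (m + 1)]
      simp only [Nat.add_sub_add_right, Nat.add_zero, Nat.sub_zero]
      rw [mul_add, mul_assoc]
      congr 3
      refine funext fun k => ?_
      rw [show j + 1 + k + 1 = j + (k + 1) + 1 by ring]
  have h := key m 0
  have h2 : X.comp (T ^ 0) = X := by ext; simp
  rw [h2, basisQuadratic_mul_gaussianTerm, map_smulₛₗ, LinearMap.smul_apply] at h
  simpa using h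

end Annihilation
-- Taylor expansion of the inverse square root of the determinant.
section DetSqrtSeries

variable {V : Type*} [NormedAddCommGroup V] [InnerProductSpace ℂ V]

theorem one_sub_mem_accretive {T : V →L[ℂ] V} (hT : ‖T‖ < 1) : 1 - T ∈ accretive V := by
  intro v hv
  have h1 : (⟪v, (1 - T) v⟫_ℂ).re = ‖v‖ ^ 2 - (⟪v, T v⟫_ℂ).re := by
    simp [inner_self_eq_norm_sq_to_K, ← Complex.ofReal_pow]
  have h2 : (⟪v, T v⟫_ℂ).re ≤ ‖v‖ * (‖T‖ * ‖v‖) :=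
    (Complex.re_le_norm _).trans ((norm_inner_le_norm _ _).trans (by gcongr; exact T.le_opNorm v))
  have h3 : 0 < ‖v‖ := norm_pos_iff.2 hv
  have h4 : 0 < ‖v‖ ^ 2 * (1 - ‖T‖) := mul_pos (by positivity) (by linarith)
  rw [h1]
  linarith

theorem norm_comp_lt_one {X Y : V →L⋆[ℂ] V} (hX : ‖X‖ < 1) (hY : ‖Y‖ < 1) :
    ‖(Y.comp X : V →L[ℂ] V)‖ < 1 :=
  (ContinuousLinearMap.opNorm_comp_le Y X).trans_lt
    (mul_lt_one_of_nonneg_of_lt_one_left (norm_nonneg _) hY hX.le)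

variable [FiniteDimensional ℂ V]

theorem detSqrt_ne_zero {T : V →L[ℂ] V} (hT : ‖T‖ < 1) : detSqrt V (1 - T) ≠ 0 := by
  have hu : IsUnit (1 - T) := isUnit_one_sub_of_norm_lt_one hT
  have hdet : (1 - T).det ≠ 0 :=
    (LinearMap.isUnit_det _ (hu.map (ContinuousLinearMap.toLinearMapRingHom :
      (V →L[ℂ] V) →+* V →ₗ[ℂ] V))).ne_zero
  rw [← (detSqrt_spec V).2.1 _ (one_sub_mem_accretive hT)] at hdet
  exact fun h => hdet (by rw [h]; simp)

/-- The determinant of `1 + zS` is a polynomial in `z` with constant term `1` and linear coefficient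
the trace; the rest is divisible by `z ^ 2`. -/
theorem hasDerivAt_det_one_add_smul (S : V →L[ℂ] V) :
    HasDerivAt (fun z : ℂ => (1 + z • S).det) (LinearMap.trace ℂ V (S : V →ₗ[ℂ] V)) 0 := by
  set b := (stdOrthonormalBasis ℂ V).toBasis
  set M := LinearMap.toMatrix b b (S : V →ₗ[ℂ] V) with hM
  have h : ∀ z : ℂ, (1 + z • S).det = 1 + M.trace * z +
      (1 + (Polynomial.X : Polynomial ℂ) • M.map Polynomial.C).det.divX.divX.eval z * z ^ 2 := by
    intro z
    rw [← Matrix.det_one_add_smul, ContinuousLinearMap.det, ← LinearMap.det_toMatrix b]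
    congr 1
    simp [hM, ContinuousLinearMap.toLinearMap_add, LinearMap.toMatrix_one]
  simp only [h]
  rw [LinearMap.trace_eq_matrix_trace ℂ b, ← hM]
  have h1 := (((hasDerivAt_id (0 : ℂ)).const_mul M.trace).const_add 1).add
    (((1 + (Polynomial.X : Polynomial ℂ) • M.map Polynomial.C).det.divX.divX.hasDerivAt 0).mul
      (hasDerivAt_pow 2 (0 : ℂ)))
  exact h1.congr_deriv (by simp)

/-- Jacobi's formula for the logarithmic derivative of `det (1 - z T)`. -/
theorem hasDerivAt_det_one_sub_smul (T : V →L[ℂ] V) {z : ℂ} (hz : IsUnit (1 - z • T)) :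
    HasDerivAt (fun w : ℂ => (1 - w • T).det) (-((1 - z • T).det *
      LinearMap.trace ℂ V ((T * Ring.inverse (1 - z • T) : V →L[ℂ] V) : V →ₗ[ℂ] V))) z := by
  set R := Ring.inverse (1 - z • T)
  -- Factoring out `1 - zT` moves the base point from `z` to `0`, where the derivative is already
  -- known.
  have hfac : ∀ w : ℂ, (1 - w • T).det = (1 + (w - z) • -(T * R)).det * (1 - z • T).det := by
    intro w
    have : 1 - w • T = (1 + (w - z) • -(T * R)) * (1 - z • T) := by
      rw [add_mul, one_mul, smul_mul_assoc, neg_mul, mul_assoc, Ring.inverse_mul_cancel _ hz,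
        mul_one, sub_smul]
      module
    rw [this]
    exact LinearMap.det_comp _ _
  rw [funext hfac]
  have h := (hasDerivAt_det_one_add_smul (-(T * R)))
  rw [← sub_self z] at h
  have h2 := (h.comp_sub_const z z).mul_const (1 - z • T).det
  refine h2.congr_deriv ?_
  rw [ContinuousLinearMap.toLinearMap_neg, map_neg]
  ring

/-- Differentiating `s ^ 2 = det` and using Jacobi's formula gives `2 s s' = -s ^ 2 t`, with `t` the
trace, so `(1/s)' = ½ t / s`. The bound on `ρ` keeps `1 - wT` accretive for `w` in the ball. -/
theorem hasDerivAt_inv_detSqrt (T : V →L[ℂ] V) {ρ : ℝ} (hρ : ρ * ‖T‖ < 1) {z : ℂ}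
    (hz : z ∈ Metric.ball 0 ρ) :
    HasDerivAt (fun w : ℂ => (detSqrt V (1 - w • T))⁻¹)
      (2⁻¹ * LinearMap.trace ℂ V ((T * Ring.inverse (1 - z • T) : V →L[ℂ] V) : V →ₗ[ℂ] V) *
        (detSqrt V (1 - z • T))⁻¹) z := by
  have hlt : ∀ w ∈ Metric.ball (0 : ℂ) ρ, ‖w • T‖ < 1 := fun w hw => by
    rw [norm_smul]
    exact lt_of_le_of_lt (by gcongr; exact (mem_ball_zero_iff.1 hw).le) hρ
  have hd : DifferentiableAt ℂ (fun w : ℂ => detSqrt V (1 - w • T)) z := by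
    refine DifferentiableOn.differentiableAt (s := Metric.ball 0 ρ) ?_
      (Metric.isOpen_ball.mem_nhds hz)
    exact (detSqrt_spec V).1.comp (by fun_prop) fun w hw => one_sub_mem_accretive (hlt w hw)
  have hne := detSqrt_ne_zero (hlt z hz)
  have hsq : (fun w : ℂ => detSqrt V (1 - w • T) ^ 2) =ᶠ[nhds z] fun w => (1 - w • T).det := by
    filter_upwards [Metric.isOpen_ball.mem_nhds hz] with w hw
    exact (detSqrt_spec V).2.1 _ (one_sub_mem_accretive (hlt w hw))
  have h1 := (hd.hasDerivAt.pow 2).unique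
    ((hasDerivAt_det_one_sub_smul T (isUnit_one_sub_of_norm_lt_one (hlt z hz))).congr_of_eventuallyEq
      hsq)
  rw [← hsq.eq_of_nhds] at h1
  refine (hd.hasDerivAt.fun_inv hne).congr_deriv ?_
  generalize deriv (fun w : ℂ => detSqrt V (1 - w • T)) z = s' at h1 ⊢
  generalize LinearMap.trace ℂ V _ = t at h1 ⊢
  generalize detSqrt V (1 - z • T) = s at h1 hne ⊢
  have h2 : s' = -(2⁻¹ * t * s) := by
    apply mul_left_cancel₀ (mul_ne_zero two_ne_zero hne)
    simp only [Nat.cast_ofNat, Nat.add_one_sub_one, pow_one] at h1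
    rw [h1]
    ring
  rw [h2]
  field_simp

/-- The Neumann series, precomposed with `z ↦ zT` and followed by the functional `S ↦ tr(TS)`, is a
power series with coefficients `tr(T^(k+1))`. -/
theorem analyticAt_trace_mul_inverse (T : V →L[ℂ] V) :
    AnalyticAt ℂ (fun z : ℂ => LinearMap.trace ℂ V
      ((T * Ring.inverse (1 - z • T) : V →L[ℂ] V) : V →ₗ[ℂ] V)) 0 ∧
    ∀ k, iteratedDeriv k (fun z : ℂ => LinearMap.trace ℂ V
      ((T * Ring.inverse (1 - z • T) : V →L[ℂ] V) : V →ₗ[ℂ] V)) 0 =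
      (k.factorial : ℂ) * LinearMap.trace ℂ V ((T ^ (k + 1) : V →L[ℂ] V) : V →ₗ[ℂ] V) := by
  set τ : (V →L[ℂ] V) →L[ℂ] ℂ := LinearMap.toContinuousLinearMap
    ((LinearMap.trace ℂ V ∘ₗ ContinuousLinearMap.coeLM ℂ) ∘ₗ LinearMap.mulLeft ℂ T) with hτ
  set u : ℂ →L[ℂ] (V →L[ℂ] V) := ContinuousLinearMap.toSpanSingleton ℂ T with hu
  have h := (hasFPowerSeriesOnBall_inverse_one_sub ℂ (V →L[ℂ] V))
  rw [← map_zero u] at h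
  have h2 := τ.comp_hasFPowerSeriesOnBall (h.compContinuousLinearMap (u := u))
  refine ⟨h2.analyticAt, fun k => ?_⟩
  have h3 := h2.factorial_smul 1 k
  rw [iteratedDeriv_eq_iteratedFDeriv]
  refine Eq.trans h3.symm ?_
  rw [nsmul_eq_mul]
  congr 1
  have h4 : (formalMultilinearSeries_geometric ℂ (V →L[ℂ] V)).compContinuousLinearMap u k
      (fun _ => 1) = T ^ k := by
    rw [FormalMultilinearSeries.compContinuousLinearMap_apply, formalMultilinearSeries_geometric,
      ContinuousMultilinearMap.mkPiAlgebraFin_apply]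
    simp [hu, Function.comp_def]
  refine (congrArg τ h4).trans ?_
  rw [pow_succ']
  rfl

/-- The Taylor expansion of `Det (1 - z T) ^ (-1/2)`, its coefficients being given by Newton's
recursion in the traces of the powers of `T`. -/
theorem hasSum_inv_detSqrt (T : V →L[ℂ] V) (c : ℕ → ℂ) (h0 : c 0 = 1)
    (hc : ∀ m : ℕ, ((m : ℂ) + 1) * c (m + 1) = 2⁻¹ * ∑ k ∈ Finset.range (m + 1),
      LinearMap.trace ℂ V ((T ^ (k + 1) : V →L[ℂ] V) : V →ₗ[ℂ] V) * c (m - k))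
    {ρ : ℝ} (hρ : ρ * ‖T‖ < 1) {z : ℂ} (hz : ‖z‖ < ρ) :
    HasSum (fun m => z ^ m * c m) (detSqrt V (1 - z • T))⁻¹ := by
  set φ : ℂ → ℂ := fun w => (detSqrt V (1 - w • T))⁻¹ with hφ
  set q : ℂ → ℂ := fun w => LinearMap.trace ℂ V
      ((T * Ring.inverse (1 - w • T) : V →L[ℂ] V) : V →ₗ[ℂ] V) with hq
  have hd : ∀ w ∈ Metric.ball (0 : ℂ) ρ, HasDerivAt φ (2⁻¹ * q w * φ w) w := fun w hw =>
    hasDerivAt_inv_detSqrt T hρ hw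
  have h0ρ : (0 : ℂ) ∈ Metric.ball (0 : ℂ) ρ := by
    simpa using (norm_nonneg z).trans_lt hz
  have hφd : DifferentiableOn ℂ φ (Metric.ball 0 ρ) := fun w hw =>
    (hd w hw).differentiableAt.differentiableWithinAt
  have hφa : AnalyticAt ℂ φ 0 := hφd.analyticAt (Metric.isOpen_ball.mem_nhds h0ρ)
  obtain ⟨hqa, hqi⟩ := analyticAt_trace_mul_inverse T
  have hderiv : deriv φ =ᶠ[nhds 0] fun w => 2⁻¹ * (q w * φ w) := by
    filter_upwards [Metric.isOpen_ball.mem_nhds h0ρ] with w hw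
    rw [(hd w hw).deriv, mul_assoc]
  -- Leibniz's rule applied to `φ' = ½ q φ` at `0`: the binomial coefficients combine with the
  -- factorials of the two factors into `m!`, which leaves the recursion for `c`.
  have hcoef : ∀ m, iteratedDeriv m φ 0 = (m.factorial : ℂ) * c m := by
    intro m
    induction m using Nat.strong_induction_on with
    | _ m ih =>
      cases m with
      | zero => simp [hφ, h0, (detSqrt_spec V).2.2]
      | succ m =>
        rw [iteratedDeriv_succ', hderiv.iteratedDeriv_eq, iteratedDeriv_const_mul_field,
          iteratedDeriv_fun_mul hqa.contDiffAt hφa.contDiffAt, Nat.factorial_succ, Nat.cast_mul,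
          mul_right_comm, Nat.cast_succ, hc]
        simp only [Finset.mul_sum, Finset.sum_mul]
        refine Finset.sum_congr rfl fun k hk => ?_
        have hk' : k ≤ m := Nat.lt_succ_iff.1 (Finset.mem_range.1 hk)
        rw [hqi, ih (m - k) (by omega), ← Nat.choose_mul_factorial_mul_factorial hk']
        push_cast
        ring
  have h := Complex.hasSum_taylorSeries_on_ball hφd (mem_ball_zero_iff.2 hz)
  have e : (fun m => z ^ m * c m) =
      fun m : ℕ => (m.factorial : ℂ)⁻¹ • (z - 0) ^ m • iteratedDeriv m φ 0 := by
    funext m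
    have : (m.factorial : ℂ) ≠ 0 := by exact_mod_cast m.factorial_ne_zero
    rw [hcoef, sub_zero, smul_eq_mul, smul_eq_mul]
    field_simp
  rw [e]
  exact h

end DetSqrtSeries
-- Convergence of Gaussians in Fock space and evaluation of their inner product.
section GaussianInner

variable {V : Type*} [NormedAddCommGroup V] [InnerProductSpace ℂ V] [FiniteDimensional ℂ V]

theorem symInner_symPower_ne {d n : ℕ} (h : d ≠ n) {θ ψ : SymmetricAlgebra ℂ V}
    (hθ : θ ∈ symPower V d) (hψ : ψ ∈ symPower V n) : symInner V θ ψ = 0 := by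
  have := symPower_le_span d hθ
  clear hθ
  induction this using Submodule.span_induction with
  | mem θ hθ => obtain ⟨x, rfl⟩ := hθ; exact symInner_prod_symPower h x hψ
  | zero => simp
  | add a b _ _ ha hb => rw [map_add, LinearMap.add_apply, ha, hb, add_zero]
  | smul c a _ ha => rw [map_smulₛₗ, LinearMap.smul_apply, ha, smul_zero]

theorem gaussian_eq_finsum (Z : V →L⋆[ℂ] V) (hZ : IsSymmetricAntilinear Z)
    (θ : SymmetricAlgebra ℂ V) :
    gaussian Z hZ θ = ∑ᶠ d : ℕ, symInner V θ (gaussianTerm Z d) := by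
  rw [gaussian_apply, quadratic_eq_basisQuadratic]
  exact finsum_congr fun d => by rw [gaussianTerm, map_smul, smul_eq_mul]

theorem gaussian_gaussianTerm (X Y : V →L⋆[ℂ] V) (hY : IsSymmetricAntilinear Y) (d : ℕ) :
    gaussian Y hY (gaussianTerm X d) = symInner V (gaussianTerm X d) (gaussianTerm Y d) := by
  rw [gaussian_eq_finsum]
  exact finsum_eq_single _ d fun n hn =>
    symInner_symPower_ne (by omega) (gaussianTerm_mem X d) (gaussianTerm_mem Y n)

theorem exists_one_lt_mul_lt_one {a : ℝ} (ha0 : 0 ≤ a) (ha : a < 1) : ∃ ρ : ℝ, 1 < ρ ∧ ρ * a < 1 := by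
  refine ⟨2 / (1 + a), ?_, ?_⟩
  · rw [lt_div_iff₀ (by linarith)]; linarith
  · rw [div_mul_eq_mul_div, div_lt_one (by linarith)]; linarith

/-- The parameter `z` serves twice: `z = 1` gives the inner product, and a real `z > 1` with `X = Y`
gives decay of the norms. -/
theorem hasSum_symInner_gaussianTerm {X Y : V →L⋆[ℂ] V} (hX : IsSymmetricAntilinear X)
    (hY : IsSymmetricAntilinear Y) {ρ : ℝ} (hρ : ρ * ‖(Y.comp X : V →L[ℂ] V)‖ < 1) {z : ℂ}
    (hz : ‖z‖ < ρ) :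
    HasSum (fun m => z ^ m * symInner V (gaussianTerm X m) (gaussianTerm Y m))
      (detSqrt V (1 - z • (Y.comp X : V →L[ℂ] V)))⁻¹ := by
  refine hasSum_inv_detSqrt _ _ ?_ (symInner_gaussianTerm_succ hX hY) hρ hz
  simpa [gaussianTerm_zero] using symInner_prod (V := V) (d := 0) Fin.elim0 Fin.elim0

theorem norm_sq_eq_symInner (θ : SymmetricAlgebra ℂ V) : ‖symInner V θ θ‖ = ‖θ‖ ^ 2 := by
  rw [← inner_eq_symInner, inner_self_eq_norm_sq_to_K]
  simp

theorem summable_norm_gaussianTerm {Z : V →L⋆[ℂ] V} (hZ : Z ∈ siegelDomain V) :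
    Summable fun d => ‖gaussianTerm Z d‖ := by
  obtain ⟨ρ, hρ1, hρ⟩ := exists_one_lt_mul_lt_one (norm_nonneg _) (norm_comp_lt_one hZ.2 hZ.2)
  obtain ⟨s, hs1, hsρ⟩ := exists_between hρ1
  have hs0 : 0 < s := by linarith
  have h1 := (hasSum_symInner_gaussianTerm hZ.1 hZ.1 hρ (z := (s : ℂ))
    (by simpa [abs_of_pos hs0] using hsρ)).summable.norm
  have h2 : Summable fun m : ℕ => (s⁻¹) ^ m :=
    summable_geometric_of_lt_one (by positivity) (inv_lt_one_of_one_lt₀ hs1)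
  refine (h1.add h2).of_nonneg_of_le (fun _ => norm_nonneg _) fun m => ?_
  rw [norm_mul, norm_pow, norm_sq_eq_symInner, Complex.norm_real, Real.norm_of_nonneg hs0.le, inv_pow]
  set a := ‖gaussianTerm Z m‖
  have ht : 0 < s ^ m := by positivity
  have ha : 0 ≤ a := norm_nonneg _
  generalize s ^ m = t at ht
  -- With `t = s ^ m`, this is `a ≤ t a ^ 2 + t⁻¹`. It bounds the norm by a term of the series of
  -- squared norms at `s > 1` plus a term of a convergent geometric series.
  have hle : 0 ≤ t⁻¹ * ((t * a - 1) ^ 2 + t * a) := by positivity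
  have he : t⁻¹ * ((t * a - 1) ^ 2 + t * a) = t * a ^ 2 + t⁻¹ - a := by
    field_simp
    ring
  linarith

/-- The Gaussian of `Z` as a vector in Fock space. -/
noncomputable def gaussianVector (Z : V →L⋆[ℂ] V) : Fock V := ∑' d, (gaussianTerm Z d : Fock V)

theorem hasSum_gaussianVector {Z : V →L⋆[ℂ] V} (hZ : Z ∈ siegelDomain V) :
    HasSum (fun d => (gaussianTerm Z d : Fock V)) (gaussianVector Z) := by
  refine Summable.hasSum (Summable.of_norm ?_)
  simpa only [UniformSpace.Completion.norm_coe] using summable_norm_gaussianTerm hZ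

/-- Pairing with a fixed `θ` is continuous and kills all but finitely many terms, so the
norm-convergent series becomes the finite sum that defines the Gaussian. -/
theorem toAntidual_gaussianVector {Z : V →L⋆[ℂ] V} (hZ : Z ∈ siegelDomain V) :
    Fock.toAntidual V (gaussianVector Z) = gaussian Z hZ.1 := by
  ext θ
  rw [Fock.toAntidual_apply, gaussian_eq_finsum]
  have h := (hasSum_gaussianVector hZ).mapL (innerSL ℂ (θ : Fock V))
  simp only [innerSL_apply_apply, UniformSpace.Completion.inner_coe, inner_eq_symInner] at h
  rw [← h.tsum_eq]
  refine tsum_eq_finsum ((finite_symInner_pow (basisQuadratic_mem Z) θ).subset fun d hd h0 => hd ?_)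
  change symInner V θ (gaussianTerm Z d) = 0
  rw [gaussianTerm, map_smul, h0, smul_zero]

theorem inner_gaussianVector {X Y : V →L⋆[ℂ] V} (hX : X ∈ siegelDomain V)
    (hY : Y ∈ siegelDomain V) :
    ⟪gaussianVector X, gaussianVector Y⟫_ℂ = (detSqrt V (1 - Y.comp X))⁻¹ := by
  -- Only the first argument is expanded. Each term is then the antifunctional of `Y` at a
  -- homogeneous element, where one degree contributes, so no double series arises.
  have h1 : HasSum (fun d => ⟪(gaussianTerm X d : Fock V), gaussianVector Y⟫_ℂ)
      ⟪gaussianVector X, gaussianVector Y⟫_ℂ :=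
    (hasSum_gaussianVector hX).map ((innerₛₗ ℂ).flip (gaussianVector Y)) (by
      exact continuous_id.inner continuous_const)
  simp only [← Fock.toAntidual_apply, toAntidual_gaussianVector hY, gaussian_gaussianTerm] at h1
  obtain ⟨ρ, hρ1, hρ⟩ := exists_one_lt_mul_lt_one (norm_nonneg _) (norm_comp_lt_one hX.2 hY.2)
  have h2 := hasSum_symInner_gaussianTerm hX.1 hY.1 hρ (z := 1) (by simpa using hρ1)
  simp only [one_pow, one_mul, one_smul] at h2
  exact h1.unique h2

end GaussianInner

end BosonicFock

theorem theorem5 {V : Type*} [NormedAddCommGroup V] [InnerProductSpace ℂ V]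
    [FiniteDimensional ℂ V] (X Y : V →L⋆[ℂ] V)
    (hX : X ∈ BosonicFock.siegelDomain V) (hY : Y ∈ BosonicFock.siegelDomain V) :
    BosonicFock.gaussian X hX.1 ∈ LinearMap.range (BosonicFock.Fock.toAntidual V) ∧
    BosonicFock.gaussian Y hY.1 ∈ LinearMap.range (BosonicFock.Fock.toAntidual V) ∧
    (1 - Y.comp X : V →L[ℂ] V) ∈ BosonicFock.accretive V ∧
    ∀ Φ Ψ : BosonicFock.Fock V, BosonicFock.Fock.toAntidual V Φ = BosonicFock.gaussian X hX.1 →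
      BosonicFock.Fock.toAntidual V Ψ = BosonicFock.gaussian Y hY.1 →
      ⟪Φ, Ψ⟫_ℂ = (BosonicFock.detSqrt V (1 - Y.comp X))⁻¹ := by
  refine ⟨⟨_, BosonicFock.toAntidual_gaussianVector hX⟩,
    ⟨_, BosonicFock.toAntidual_gaussianVector hY⟩,
    BosonicFock.one_sub_mem_accretive (BosonicFock.norm_comp_lt_one hX.2 hY.2),
    fun Φ Ψ hΦ hΨ => ?_⟩
  rw [← BosonicFock.toAntidual_gaussianVector hX] at hΦ
  rw [← BosonicFock.toAntidual_gaussianVector hY] at hΨ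
  -- A Gaussian has only one representative in Fock space, so `Φ` and `Ψ` are the vectors already
  -- constructed.
  rw [BosonicFock.Fock.toAntidual_injective hΦ, BosonicFock.Fock.toAntidual_injective hΨ]
  exact BosonicFock.inner_gaussianVector hX hY
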